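/- Fix a field $k$. For a finite poset $\mathcal{P}$, a $\mathcal{P}$-module is a functor from $\mathcal{P}$ to finite-dimensional $k$-vector spaces; $\mathrm{mod}\,\mathcal{P}$ is the abelian category of $\mathcal{P}$-modules, and $\mathrm{Ind}\,\mathcal{P}$ is the set of isomorphism classes of indecomposable $\mathcal{P}$-modules. Call $\mathcal{P}$ representation-finite if $\mathrm{Ind}\,\mathcal{P}$ is finite. For finite posets $\mathcal{X},\mathcal{P}$, let $\mathrm{Emb}_{\mathcal{X}}^{\mathcal{P}}$ be the set of order-embeddings $f:\mathcal{X}\to\mathcal{P}$ (i.e. $x\le x'\iff f(x)\le f(x')$) up to automorphisms of $\mathcal{X}$. Let $f^*:\mathrm{mod}\,\mathcal{P}\to\mathrm{mod}\,\mathcal{X}$ be restriction along $f$ and $f_!$ its left adjoint. Let $\mathcal{X}$ be a representation-finite finite poset, let $\mathcal{P}$ be a finite poset, and let $\mathrm{E}\subseteq \mathrm{Emb}_{\mathcal{X}}^{\mathcal{P}}$ satisfy $\mathcal{P}=\bigcup_{f\in\mathrm{E}}\operatorname{Im} f$. Let $$\mathcal{H}^{\mathrm{E}}=\{f_!U \mid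 f\in\mathrm{E},\ U\in \mathrm{Ind}\,\mathcal{X}\},$$ a set of isomorphism classes of $\mathcal{P}$-modules. Let $\mathcal{E}^{\mathrm{E}}_{\mathcal{P}}$ be the class of short exact sequences $0\to L\to M\to N\to 0$ in $\mathrm{mod}\,\mathcal{P}$ such that $0\to f^*L\to f^*M\to f^*N\to 0$ splits for every $f\in\mathrm{E}$. For a set $\mathcal{U}$ of (isomorphism classes of) $\mathcal{P}$-modules, let $\mathcal{E}_{\mathcal{U}}$ be the class of short exact sequences $0\to L\to M\xrightarrow{g} N\to 0$ in $\mathrm{mod}\,\mathcal{P}$ such that $\mathrm{Hom}_{\mathcal{P}}(U,g)$ is surjective for all $U\in\mathcal{U}$. Then: 1. $\mathcal{H}^{\mathrm{E}}\subseteq\mathrm{Ind}\,\mathcal{P}$, and $\mathcal{H}^{\mathrm{E}}$ contains every indecomposable projective $\mathcal{P}$-module. 2. $\mathcal{E}^{\mathrm{E}}_{\mathcal{P}}$ is an exact structure on $\mathrm{mod}\,\mathcal{P}$ (a class of short exact sequences, closed under isomorphism, that contains all split exact sequences, whose admissible monomorphisms are closed under composition and pushouts, and whose admissible epimorphisms are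 closed under composition and pullbacks), and $\mathcal{E}^{\mathrm{E}}_{\mathcal{P}}=\mathcal{E}_{\mathcal{H}^{\mathrm{E}}}$. 3. Call $M\in\mathrm{mod}\,\mathcal{P}$ relatively projective if $\mathrm{Hom}_{\mathcal{P}}(M,g)$ is surjective for every right-hand map $g$ of a sequence in $\mathcal{E}^{\mathrm{E}}_{\mathcal{P}}$. Up to isomorphism, the indecomposable relatively projective $\mathcal{P}$-modules are exactly the elements of $\mathcal{H}^{\mathrm{E}}$, and the relatively projective $\mathcal{P}$-modules are exactly the finite direct sums (including the empty sum $0$) of elements of $\mathcal{H}^{\mathrm{E}}$. -/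

import Mathlib

open CategoryTheory CategoryTheory.Limits

noncomputable section

namespace PosetRep

universe u v w w'

section ExactStructures

variable {C : Type v} [Category.{w} C] [Abelian C]

/-- `f` is an admissible monomorphism for the class `𝓔`: it is the left map of a sequence
in `𝓔`. -/
def AdmissibleMono (𝓔 : ObjectProperty (ShortComplex C)) {A B : C} (f : A ⟶ B) : Prop :=
  ∃ (D : C) (g : B ⟶ D) (h : f ≫ g = 0), 𝓔 (ShortComplex.mk f g h)

/-- `g` is an admissible epimorphism for the class `𝓔`: it is the right map of a sequence
in `𝓔`. -/
def AdmissibleEpi (𝓔 : ObjectProperty (ShortComplex C)) {B D : C} (g : B ⟶ D) : Prop :=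
  ∃ (A : C) (f : A ⟶ B) (h : f ≫ g = 0), 𝓔 (ShortComplex.mk f g h)

/-- A class of short exact sequences of an abelian category is an exact structure (in the sense
of Quillen) on it. -/
structure IsExactStructure (𝓔 : ObjectProperty (ShortComplex C)) : Prop where
  shortExact : ∀ S, 𝓔 S → S.ShortExact
  of_iso : ∀ S T, (S ≅ T) → 𝓔 S → 𝓔 T
  of_split : ∀ S : ShortComplex C, Nonempty S.Splitting → 𝓔 S
  comp_mono : ∀ {X Y Z : C} (f : X ⟶ Y) (g : Y ⟶ Z),
    AdmissibleMono 𝓔 f → AdmissibleMono 𝓔 g → AdmissibleMono 𝓔 (f ≫ g)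
  comp_epi : ∀ {X Y Z : C} (f : X ⟶ Y) (g : Y ⟶ Z),
    AdmissibleEpi 𝓔 f → AdmissibleEpi 𝓔 g → AdmissibleEpi 𝓔 (f ≫ g)
  pushout : ∀ {X Y W Z : C} (f : X ⟶ Y) (h : X ⟶ W) (h' : Y ⟶ Z) (f' : W ⟶ Z),
    IsPushout f h h' f' → AdmissibleMono 𝓔 f → AdmissibleMono 𝓔 f'
  pullback : ∀ {W Z X Y : C} (h' : W ⟶ X) (f' : W ⟶ Z) (f : X ⟶ Y) (h : Z ⟶ Y),
    IsPullback h' f' f h → AdmissibleEpi 𝓔 f → AdmissibleEpi 𝓔 f'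

/-- The class of split short exact sequences. -/
def splitStructure (C : Type v) [Category.{w} C] [Abelian C] :
    ObjectProperty (ShortComplex C) :=
  fun S => Nonempty S.Splitting

/-- The class of short exact sequences on whose right map `Hom(U, -)` is surjective for all `U`
in `𝓤`. -/
def homSurjectiveStructure (𝓤 : ObjectProperty C) : ObjectProperty (ShortComplex C) :=
  fun S => S.ShortExact ∧
    ∀ U, 𝓤 U → Function.Surjective (fun t : U ⟶ S.X₂ => t ≫ S.g)

/-- The projective objects relative to `𝓔`: `Hom(M, -)` maps admissible epimorphisms to
surjections. -/
def RelProjective (𝓔 : ObjectProperty (ShortComplex C)) : ObjectProperty C :=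
  fun M => ∀ ⦃Y Z : C⦄ (g : Y ⟶ Z), AdmissibleEpi 𝓔 g →
    Function.Surjective (fun t : M ⟶ Y => t ≫ g)

attribute [local instance] Abelian.hasFiniteBiproducts

/-- Finite direct sums (including the empty one) of objects in `𝓤`, up to isomorphism. -/
def FiniteSums (𝓤 : ObjectProperty C) : ObjectProperty C :=
  fun M => ∃ (n : ℕ) (U : Fin n → C), (∀ i, 𝓤 (U i)) ∧ Nonempty (M ≅ ⨁ U)

end ExactStructures

/-- The category of representations of the poset `P` over the field `k`: functors from `P` to
finite-dimensional vector spaces. -/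
abbrev Rep (k : Type u) [Field k] (P : Type w) [PartialOrder P] : Type _ :=
  P ⥤ FGModuleCat.{u} k

/-- The set of isomorphism classes of indecomposable `P`-modules. -/
def Ind (k : Type u) [Field k] (P : Type w) [PartialOrder P] :
    Set (Quotient (isIsomorphicSetoid (Rep k P))) :=
  {c | ∃ M : Rep k P, Indecomposable M ∧ Quotient.mk _ M = c}

/-- `P` is of finite representation type over `k`. -/
def RepresentationFinite (k : Type u) [Field k] (P : Type w) [PartialOrder P] : Prop :=
  (Ind k P).Finite

section Embeddings

variable {X : Type w} {P : Type w'} [PartialOrder X] [PartialOrder P]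

/-- Two order-embeddings are equivalent if they differ by an automorphism of the source. -/
def embSetoid (X : Type w) (P : Type w') [PartialOrder X] [PartialOrder P] : Setoid (X ↪o P) where
  r f g := ∃ σ : X ≃o X, ∀ x, g x = f (σ x)
  iseqv :=
    { refl := fun _ => ⟨OrderIso.refl X, fun _ => rfl⟩
      symm := by
        rintro f g ⟨σ, h⟩
        exact ⟨σ.symm, fun x => by simp [h]⟩
      trans := by
        rintro f g l ⟨σ, h⟩ ⟨τ, h'⟩
        exact ⟨τ.trans σ, fun x => by simp [h, h']⟩ }

/-- Order-embeddings of `X` into `P` up to automorphisms of `X`. -/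
def Emb (X : Type w) (P : Type w') [PartialOrder X] [PartialOrder P] : Type _ :=
  Quotient (embSetoid X P)

/-- The class of an order-embedding modulo automorphisms of the source. -/
def Emb.mk (f : X ↪o P) : Emb X P := Quotient.mk (embSetoid X P) f

/-- An order-embedding as a functor. -/
abbrev embFunctor (f : X ↪o P) : X ⥤ P := f.monotone.functor

/-- The category of pairs `(x, f x ≤ p)` is the poset of all `x` with `f x ≤ p`. -/
def costructuredArrowEquiv (f : X ↪o P) (p : P) :
    CostructuredArrow (embFunctor f) p ≌ {x : X // f x ≤ p} where
  functor :=
    { obj := fun a => ⟨a.left, leOfHom a.hom⟩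
      map := fun φ => homOfLE (Subtype.mk_le_mk.mpr (leOfHom φ.left))
      map_id := fun _ => Subsingleton.elim _ _
      map_comp := fun _ _ => Subsingleton.elim _ _ }
  inverse :=
    { obj := fun x => CostructuredArrow.mk (Y := x.1) (homOfLE x.2)
      map := fun φ => CostructuredArrow.homMk (homOfLE (leOfHom φ)) (Subsingleton.elim _ _)
      map_id := fun _ => by ext; exact Subsingleton.elim _ _
      map_comp := fun _ _ => by ext; exact Subsingleton.elim _ _ }
  unitIso := NatIso.ofComponents
    (fun a => CostructuredArrow.isoMk (Iso.refl _) (Subsingleton.elim _ _))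
    (fun _ => by ext; exact Subsingleton.elim _ _)
  counitIso := NatIso.ofComponents (fun _ => Iso.refl _) (fun _ => Subsingleton.elim _ _)
  functor_unitIso_comp := fun _ => Subsingleton.elim _ _

variable (k : Type u) [Field k]

instance hasLeftKanExtension [Finite X] (f : X ↪o P) (U : Rep k X) :
    (embFunctor f).HasLeftKanExtension U := by
  have h : ∀ p, HasColimitsOfShape (CostructuredArrow (embFunctor f) p) (FGModuleCat.{u} k) := by
    intro p
    let _ : Fintype {x : X // f x ≤ p} := Fintype.ofFinite _
    exact hasColimitsOfShape_of_equivalence (costructuredArrowEquiv f p).symm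
  have : (embFunctor f).HasPointwiseLeftKanExtension U := fun p => by
    have := h p
    dsimp only [Functor.HasPointwiseLeftKanExtensionAt]
    infer_instance
  infer_instance

/-- The restriction functor `f^*`. -/
abbrev restriction (f : X ↪o P) : Rep k P ⥤ Rep k X :=
  (Functor.whiskeringLeft X P (FGModuleCat.{u} k)).obj (embFunctor f)

/-- The left adjoint `f_!` of the restriction functor `f^*` (left Kan extension along `f`). -/
def extension [Finite X] (f : X ↪o P) : Rep k X ⥤ Rep k P :=
  (embFunctor f).lan

/-- `f_!` is left adjoint to `f^*`. -/
def extensionAdjunction [Finite X] (f : X ↪o P) : extension k f ⊣ restriction k f :=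
  (embFunctor f).lanAdjunction (FGModuleCat.{u} k)

/-- The class of short exact sequences of `P`-modules whose restriction along every `f` in `E`
lies in `𝓔`. -/
def pullbackStructure (E : Set (Emb X P)) (𝓔 : ObjectProperty (ShortComplex (Rep k X))) :
    ObjectProperty (ShortComplex (Rep k P)) :=
  fun S => S.ShortExact ∧ ∀ f : X ↪o P, Emb.mk f ∈ E → 𝓔 (S.map (restriction k f))

/-- The exact structure of all short exact sequences of `P`-modules whose restriction along every
`f` in `E` splits. -/
def relStructure (E : Set (Emb X P)) : ObjectProperty (ShortComplex (Rep k P)) :=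
  pullbackStructure k E (splitStructure (Rep k X))

/-- The modules isomorphic to `f_! U` for some `f` in `E` and some indecomposable `X`-module
`U`. -/
def relHooks [Finite X] (E : Set (Emb X P)) : ObjectProperty (Rep k P) :=
  fun M => ∃ (f : X ↪o P) (U : Rep k X), Emb.mk f ∈ E ∧ Indecomposable U ∧
    Nonempty (M ≅ (extension k f).obj U)

end Embeddings

end PosetRep

end

/-!
The functor `f_!` is fully faithful, so it preserves indecomposability, which only depends on the
idempotents of the endomorphism ring. By adjunction, `Hom(f_! U, g)` is surjective if and only if
`Hom(U, f^* g)` is. As every `X`-module is a finite direct sum of indecomposables `U`, testing with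
all of them detects whether the restriction of a short exact sequence along `f` splits. Hence the
sequences split by every `f^*` are those on which all `Hom(f_! U, -)` are exact, and such a class
is always an exact structure.

For every module `M`, the sum of the counits `⨁ f_! f^* M ⟶ M` becomes a split epimorphism after
each `f^*` by a triangle identity, and it is an epimorphism since the images of the `f` cover `P`.
So it is admissible, and a relatively projective `M` is a direct summand of its source. Endomorphism
rings of indecomposables are local (Fitting), so the Krull–Schmidt argument turns such summands
into direct sums of modules `f_! U`.
-/

noncomputable section

namespace PosetRep

universe u v w w'

section Fitting

variable {A : Type*} [Ring A] [IsArtinianRing A]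

theorem isUnit_or_isNilpotent_of_forall_isIdempotentElem
    (hA : ∀ e : A, IsIdempotentElem e → e = 0 ∨ e = 1) (a : A) : IsUnit a ∨ IsNilpotent a := by
  -- Fitting: for large `n`, `A` is the direct sum of the left annihilator of `a ^ n` and of
  -- `A * a ^ n`, and the component of `1` in the first summand is idempotent.
  obtain ⟨n, hcompl, hn⟩ := ((LinearMap.mulRight A a).eventually_isCompl_ker_pow_range_pow.and
    (Filter.eventually_ne_atTop 0)).exists
  rw [LinearMap.pow_mulRight] at hcompl
  obtain ⟨u, hu, v, hv, huv⟩ :=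
    Submodule.mem_sup.mp (hcompl.sup_eq_top ▸ Submodule.mem_top (x := 1))
  have hu_idem : IsIdempotentElem u := by
    have hmem : u - u * u ∈ LinearMap.range (LinearMap.mulRight A (a ^ n)) := by
      have h : u * v = u - u * u := by rw [eq_sub_of_add_eq' huv, mul_sub, mul_one]
      exact h ▸ Submodule.smul_mem _ u hv
    exact (sub_eq_zero.mp (Submodule.disjoint_def.mp hcompl.disjoint _
      (sub_mem hu (Submodule.smul_mem _ u hu)) hmem)).symm
  rcases hA u hu_idem with rfl | rfl
  · obtain ⟨w, hw : w * a ^ n = v⟩ := hv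
    rw [zero_add] at huv
    exact .inl ((isUnit_pow_iff hn).mp (.of_mul_eq_one_right w (hw.trans huv)))
  · exact .inr ⟨n, by simpa using hu⟩

theorem isLocalRing_of_forall_isIdempotentElem [Nontrivial A]
    (hA : ∀ e : A, IsIdempotentElem e → e = 0 ∨ e = 1) : IsLocalRing A :=
  .of_isUnit_or_isUnit_one_sub_self fun a =>
    (isUnit_or_isNilpotent_of_forall_isIdempotentElem hA a).imp_right IsNilpotent.isUnit_one_sub

end Fitting

section Indecomposable

variable {C : Type v} [Category.{w} C] [Preadditive C]

theorem isZero_of_retract_of_comp_eq_zero {M N : C} (h : Retract M N) (h0 : h.r ≫ h.i = 0) :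
    IsZero M := by
  rw [IsZero.iff_id_eq_zero]
  calc 𝟙 M = h.i ≫ (h.r ≫ h.i) ≫ h.r := by simp
    _ = 0 := by simp [h0]

variable [HasBinaryBiproducts C]

/-- An object whose identity is the sum of the two idempotents defined by retracts `Y` and `Z` is
the biproduct of `Y` and `Z`. -/
def isoBiprodOfTotal {M Y Z : C} (h : Retract Y M) (h' : Retract Z M)
    (total : h.r ≫ h.i + h'.r ≫ h'.i = 𝟙 M) : M ≅ Y ⊞ Z :=
  have inl_snd : h.i ≫ h'.r = 0 := by simpa using h.i ≫= total =≫ h'.r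
  have inr_fst : h'.i ≫ h.r = 0 := by simpa using h'.i ≫= total =≫ h.r
  biprod.uniqueUpToIso Y Z (isBinaryBilimitOfTotal
    { pt := M, fst := h.r, snd := h'.r, inl := h.i, inr := h'.i, inl_snd, inr_fst } total)

instance : ObjectProperty.IsClosedUnderIsomorphisms (Indecomposable (C := C)) where
  of_iso e hM := ⟨fun h => hM.1 (h.of_iso e), fun Y Z φ => hM.2 Y Z (e ≪≫ φ)⟩

variable [IsIdempotentComplete C]

theorem indecomposable_iff {M : C} :
    Indecomposable M ↔ ¬ IsZero M ∧ ∀ e : M ⟶ M, e ≫ e = e → e = 0 ∨ e = 𝟙 M := by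
  refine and_congr_right fun _ => ⟨fun hM e he => ?_, fun hM Y Z φ => ?_⟩
  · obtain ⟨Y, i, r, hir, hri⟩ := IsIdempotentComplete.idempotents_split M e he
    obtain ⟨Z, j, s, hjs, hsj⟩ := IsIdempotentComplete.idempotents_split M (𝟙 M - e) (by simp [he])
    refine (hM Y Z (isoBiprodOfTotal ⟨i, r, hir⟩ ⟨j, s, hjs⟩ (by simp [hri, hsj]))).imp
      (fun hY => ?_) fun hZ => ?_
    · rw [← hri, hY.eq_of_tgt r 0, zero_comp]
    · rw [hZ.eq_of_tgt s 0, zero_comp] at hsj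
      exact (sub_eq_zero.mp hsj.symm).symm
  · let hY : Retract Y M := ⟨biprod.inl ≫ φ.inv, φ.hom ≫ biprod.fst, by simp⟩
    let hZ : Retract Z M := ⟨biprod.inr ≫ φ.inv, φ.hom ≫ biprod.snd, by simp⟩
    have hZY : hZ.i ≫ hY.r = 0 := by simp [hY, hZ]
    refine (hM (hY.r ≫ hY.i) (by simp)).imp (isZero_of_retract_of_comp_eq_zero hY) fun hid =>
      isZero_of_retract_of_comp_eq_zero hZ ?_
    rw [← Category.comp_id hZ.i, ← hid, reassoc_of% hZY, zero_comp, comp_zero]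

theorem nonempty_iso_of_retract {M U : C} (h : Retract M U) (hU : Indecomposable U)
    (hM : ¬ IsZero M) : Nonempty (M ≅ U) := by
  rcases (indecomposable_iff.mp hU).2 (h.r ≫ h.i) (by simp) with h0 | h1
  · exact absurd (isZero_of_retract_of_comp_eq_zero h h0) hM
  · exact ⟨⟨h.i, h.r, h.retract, h1⟩⟩

theorem isLocalRing_end {M : C} [IsArtinianRing (End M)] (hM : Indecomposable M) :
    IsLocalRing (End M) :=
  have : Nontrivial (End M) := ⟨0, 1, fun h => hM.1 ((IsZero.iff_id_eq_zero M).mpr h.symm)⟩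
  isLocalRing_of_forall_isIdempotentElem fun e he => (indecomposable_iff.mp hM).2 e he

theorem indecomposable_obj {D : Type*} [Category* D] [Preadditive D] [HasBinaryBiproducts D]
    [IsIdempotentComplete D] (F : C ⥤ D) [F.PreservesZeroMorphisms] [F.Full] [F.Faithful] {M : C}
    (hM : Indecomposable M) : Indecomposable (F.obj M) := by
  obtain ⟨h0, hidem⟩ := indecomposable_iff.mp hM
  refine indecomposable_iff.mpr ⟨fun h => h0 ?_, fun e he => ?_⟩
  · rw [IsZero.iff_id_eq_zero] at h ⊢
    exact F.map_injective (by simpa using h)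
  · obtain ⟨e, rfl⟩ := F.map_surjective e
    exact (hidem e (F.map_injective (by simpa using he))).imp (by simp +contextual)
      (by simp +contextual)

end Indecomposable

section HomSurjective

variable {C : Type v} [Category.{w} C] (𝓤 : ObjectProperty C)

/-- The morphisms on which `Hom(U, -)` is surjective for all `U` in `𝓤`: the epimorphisms
relative to `𝓤`. -/
def homSurjective : MorphismProperty C :=
  fun Y _ g => ∀ U, 𝓤 U → Function.Surjective fun t : U ⟶ Y => t ≫ g

instance : (homSurjective 𝓤).IsStableUnderComposition where
  comp_mem _ _ hf hg U hU := by
    simpa only [Function.comp_def, Category.assoc] using (hg U hU).comp (hf U hU)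

instance : (homSurjective 𝓤).IsStableUnderBaseChange where
  of_isPullback sq hg U hU t := by
    obtain ⟨s, hs⟩ := hg U hU (t ≫ _)
    exact ⟨sq.lift s t hs, sq.lift_snd s t hs⟩

variable {𝓤}

theorem homSurjective_of_comp {X Y Z : C} {f : X ⟶ Y} {g : Y ⟶ Z}
    (h : homSurjective 𝓤 (f ≫ g)) : homSurjective 𝓤 g := fun U hU =>
  Function.Surjective.of_comp (g := fun t : U ⟶ X => t ≫ f)
    (by simpa only [Function.comp_def, Category.assoc] using h U hU)

theorem homSurjective_of_isSplitEpi {Y Z : C} (g : Y ⟶ Z) [IsSplitEpi g] : homSurjective 𝓤 g :=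
  fun _ _ t => ⟨t ≫ section_ g, by simp⟩

instance : (homSurjective 𝓤).RespectsIso :=
  MorphismProperty.respectsIso_of_isStableUnderComposition
    fun _ _ f (_ : IsIso f) => homSurjective_of_isSplitEpi f

theorem homSurjective_of_exact [Preadditive C] [Balanced C] {S : ShortComplex C} (hS : S.Exact)
    [Mono S.f] {Y Z : C} {g : Y ⟶ S.X₁} {p : Z ⟶ S.X₂} {i : Y ⟶ Z} (w : g ≫ S.f = i ≫ p)
    (hg : homSurjective 𝓤 g) (hp : homSurjective 𝓤 (p ≫ S.g)) : homSurjective 𝓤 p := by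
  intro U hU t
  obtain ⟨s, hs⟩ := hp U hU (t ≫ S.g)
  dsimp only at hs
  have hker : (t - s ≫ p) ≫ S.g = 0 := by simp [← hs]
  obtain ⟨s', hs' : s' ≫ g = hS.lift (t - s ≫ p) hker⟩ := hg U hU (hS.lift (t - s ≫ p) hker)
  refine ⟨s + s' ≫ i, ?_⟩
  have h : s' ≫ i ≫ p = t - s ≫ p := by rw [← w, reassoc_of% hs', hS.lift_f]
  simp [h]

theorem homSurjective_cokernel_π_of_isPushout [HasZeroMorphisms C] {X Y W Z : C} {f : X ⟶ Y}
    {h : X ⟶ W} {h' : Y ⟶ Z} {f' : W ⟶ Z} [HasCokernel f] [HasCokernel f']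
    (sq : IsPushout f h h' f') (hf : homSurjective 𝓤 (cokernel.π f)) :
    homSurjective 𝓤 (cokernel.π f') := by
  have : IsIso (cokernel.map f f' h h' sq.w) := isIso_cokernel_map_of_isPushout sq
  refine homSurjective_of_comp (f := h') ?_
  rw [← cokernel.π_desc f (h' ≫ cokernel.π f') (by simp [reassoc_of% sq.w])]
  exact (MorphismProperty.cancel_right_of_respectsIso _ _ _).mpr hf

theorem homSurjective_map_iff {D : Type*} [Category* D] {F : C ⥤ D} {G : D ⥤ C} (adj : F ⊣ G)
    {Y Z : D} (g : Y ⟶ Z) : homSurjective 𝓤 (G.map g) ↔ homSurjective (𝓤.map F) g := by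
  have key (U : C) : Function.Surjective (fun t : U ⟶ G.obj Y => t ≫ G.map g) ↔
      Function.Surjective fun t : F.obj U ⟶ Y => t ≫ g := by
    rw [← (adj.homEquiv U Y).surjective_comp, ← (adj.homEquiv U Z).comp_surjective]
    exact iff_of_eq (congrArg _ (funext fun t => (adj.homEquiv_naturality_right t g).symm))
  refine ⟨fun h => ?_, fun h U hU => (key U).mpr (h _ (𝓤.prop_map_obj F hU))⟩
  rintro V ⟨U, hU, ⟨e⟩⟩ t
  obtain ⟨s, hs : s ≫ g = e.hom ≫ t⟩ := (key U).mp (h U hU) (e.hom ≫ t)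
  exact ⟨e.inv ≫ s, by simp [hs]⟩

end HomSurjective

section ExactStructure

variable {C : Type v} [Category.{w} C] [Abelian C] {𝓤 : ObjectProperty C}

theorem admissibleEpi_homSurjectiveStructure_iff {Y Z : C} {g : Y ⟶ Z} :
    AdmissibleEpi (homSurjectiveStructure 𝓤) g ↔ Epi g ∧ homSurjective 𝓤 g := by
  constructor
  · rintro ⟨A, f, h, hS, hg⟩
    exact ⟨hS.epi_g, hg⟩
  · rintro ⟨_, hg⟩
    exact ⟨_, kernel.ι g, kernel.condition g,
      { exact := ShortComplex.exact_of_f_is_kernel _ (kernelIsKernel g) }, hg⟩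

theorem admissibleMono_homSurjectiveStructure_iff {X Y : C} {f : X ⟶ Y} :
    AdmissibleMono (homSurjectiveStructure 𝓤) f ↔
      Mono f ∧ homSurjective 𝓤 (cokernel.π f) := by
  constructor
  · rintro ⟨D, g, h, hS, hg⟩
    let e := hS.gIsCokernel.coconePointUniqueUpToIso (cokernelIsCokernel f)
    have hπ : g ≫ e.hom = cokernel.π f :=
      hS.gIsCokernel.comp_coconePointUniqueUpToIso_hom _ WalkingParallelPair.one
    exact ⟨hS.mono_f, hπ ▸ (MorphismProperty.cancel_right_of_respectsIso _ _ _).mpr hg⟩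
  · rintro ⟨_, hf⟩
    exact ⟨_, cokernel.π f, cokernel.condition f,
      { exact := ShortComplex.exact_of_g_is_cokernel _ (cokernelIsCokernel f) }, hf⟩

theorem homSurjective_cokernel_π_comp {X Y Z : C} {f : X ⟶ Y} {g : Y ⟶ Z} [Mono g]
    (hf : homSurjective 𝓤 (cokernel.π f)) (hg : homSurjective 𝓤 (cokernel.π g)) :
    homSurjective 𝓤 (cokernel.π (f ≫ g)) := by
  -- The sequence of the composition is
  -- `0 ⟶ ker f ⟶ ker (f ≫ g) ⟶ ker g ⟶ coker f ⟶ coker (f ≫ g) ⟶ coker g ⟶ 0`, with `ker g = 0`.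
  let S : ShortComplex C := .mk (cokernel.map f (f ≫ g) (𝟙 X) g (by simp))
    (cokernel.map (f ≫ g) g f (𝟙 Z) (by simp)) (by ext; simp)
  have hS : S.Exact := (kernelCokernelCompSequence_exact f g).exact 3
  have : Mono S.f := ((kernelCokernelCompSequence_exact f g).exact 2).mono_g
    ((isZero_kernel_of_mono g).eq_of_src _ _)
  exact homSurjective_of_exact hS (i := g) (by simp [S]) hf (by simpa [S] using hg)

variable (𝓤) in
theorem isExactStructure_homSurjectiveStructure :
    IsExactStructure (homSurjectiveStructure 𝓤) where
  shortExact _ hS := hS.1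
  of_iso S T e hS := by
    refine ⟨ShortComplex.shortExact_of_iso e hS.1, homSurjective_of_comp (f := e.hom.τ₂) ?_⟩
    rw [e.hom.comm₂₃]
    exact (MorphismProperty.cancel_right_of_respectsIso _ _ _).mpr hS.2
  of_split := fun S ⟨σ⟩ =>
    have := σ.isSplitEpi_g
    ⟨σ.shortExact, homSurjective_of_isSplitEpi S.g⟩
  comp_mono f g hf hg := by
    rw [admissibleMono_homSurjectiveStructure_iff] at hf hg ⊢
    have := hf.1
    have := hg.1
    exact ⟨mono_comp f g, homSurjective_cokernel_π_comp hf.2 hg.2⟩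
  comp_epi f g hf hg := by
    rw [admissibleEpi_homSurjectiveStructure_iff] at hf hg ⊢
    have := hf.1
    have := hg.1
    exact ⟨epi_comp f g, MorphismProperty.comp_mem _ f g hf.2 hg.2⟩
  pushout f h h' f' sq hf := by
    rw [admissibleMono_homSurjectiveStructure_iff] at hf ⊢
    have := hf.1
    exact ⟨Abelian.mono_inr_of_isColimit _ h sq.isColimit,
      homSurjective_cokernel_π_of_isPushout sq hf.2⟩
  pullback h' f' f h sq hf := by
    rw [admissibleEpi_homSurjectiveStructure_iff] at hf ⊢
    have := hf.1
    exact ⟨Abelian.epi_snd_of_isLimit _ h sq.isLimit,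
      MorphismProperty.of_isPullback sq hf.2⟩

end ExactStructure

section AdditiveClosure

variable {C : Type v} [Category.{w} C] [Preadditive C]

/-- The additive closure `add 𝓤`: the direct summands of finite direct sums of objects in `𝓤`.
Such a summand is given by the components of its inclusion and of its projection, so that no
biproducts are needed. -/
def additiveClosure (𝓤 : ObjectProperty C) : ObjectProperty C :=
  fun M => ∃ (n : ℕ) (U : Fin n → C) (a : ∀ i, M ⟶ U i) (b : ∀ i, U i ⟶ M),
    (∀ i, 𝓤 (U i)) ∧ ∑ i, a i ≫ b i = 𝟙 M

variable {𝓤 : ObjectProperty C}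

theorem additiveClosure_of_finite {ι : Type*} [Fintype ι] {M : C} {U : ι → C} (hU : ∀ i, 𝓤 (U i))
    (a : ∀ i, M ⟶ U i) (b : ∀ i, U i ⟶ M) (hab : ∑ i, a i ≫ b i = 𝟙 M) :
    additiveClosure 𝓤 M :=
  ⟨Fintype.card ι, U ∘ (Fintype.equivFin ι).symm, fun _ => a _, fun _ => b _, fun _ => hU _,
    ((Fintype.equivFin ι).symm.sum_comp fun i => a i ≫ b i).trans hab⟩

theorem le_additiveClosure : 𝓤 ≤ additiveClosure 𝓤 := fun M hM =>
  additiveClosure_of_finite (ι := Unit) (fun _ => hM) (fun _ => 𝟙 M) (fun _ => 𝟙 M) (by simp)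

theorem additiveClosure_additiveClosure :
    additiveClosure (additiveClosure 𝓤) = additiveClosure 𝓤 := by
  refine le_antisymm ?_ le_additiveClosure
  rintro M ⟨n, U, a, b, hU, hab⟩
  choose m V c d hV hcd using hU
  refine additiveClosure_of_finite (ι := Σ i, Fin (m i)) (fun j => hV j.1 j.2)
    (fun j => a j.1 ≫ c j.1 j.2) (fun j => d j.1 j.2 ≫ b j.1) ?_
  calc ∑ j : Σ i, Fin (m i), (a j.1 ≫ c j.1 j.2) ≫ d j.1 j.2 ≫ b j.1
      = ∑ i, a i ≫ (∑ j, c i j ≫ d i j) ≫ b i := by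
        simp only [Fintype.sum_sigma, Preadditive.sum_comp, Preadditive.comp_sum, Category.assoc]
    _ = 𝟙 M := by simp [hcd, hab]

theorem additiveClosure_mono {𝓥 : ObjectProperty C} (h : 𝓤 ≤ 𝓥) :
    additiveClosure 𝓤 ≤ additiveClosure 𝓥 :=
  fun _ ⟨n, U, a, b, hU, hab⟩ => ⟨n, U, a, b, fun i => h _ (hU i), hab⟩

theorem additiveClosure_of_retract {M N : C} (h : Retract M N) (hN : additiveClosure 𝓤 N) :
    additiveClosure 𝓤 M :=
  additiveClosure_additiveClosure.le _ <| additiveClosure_of_finite (ι := Unit) (fun _ => hN)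
    (fun _ => h.i) (fun _ => h.r) (by simp)

theorem additiveClosure_map_obj {D : Type*} [Category* D] [Preadditive D] (F : C ⥤ D) [F.Additive]
    {M : C} (hM : additiveClosure 𝓤 M) : additiveClosure (𝓤.map F) (F.obj M) := by
  obtain ⟨n, U, a, b, hU, hab⟩ := hM
  exact ⟨n, fun i => F.obj (U i), fun i => F.map (a i), fun i => F.map (b i),
    fun i => 𝓤.prop_map_obj F (hU i), by simp only [← F.map_comp, ← F.map_sum, hab, F.map_id]⟩

theorem homSurjective_additiveClosure :
    homSurjective (additiveClosure 𝓤) = homSurjective 𝓤 := by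
  ext Y Z g
  refine ⟨fun h U hU => h U (le_additiveClosure U hU), ?_⟩
  rintro h M ⟨n, U, a, b, hU, hab⟩ t
  choose s hs using fun i => h (U i) (hU i) (b i ≫ t)
  refine ⟨∑ i, a i ≫ s i, ?_⟩
  calc (∑ i, a i ≫ s i) ≫ g = ∑ i, a i ≫ s i ≫ g := by
        simp only [Preadditive.sum_comp, Category.assoc]
    _ = (∑ i, a i ≫ b i) ≫ t := by simp only [hs, Preadditive.sum_comp, Category.assoc]
    _ = t := by rw [hab, Category.id_comp]

theorem exists_retract_of_isLocalRing_end {M : C} [IsLocalRing (End M)]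
    (hM : additiveClosure 𝓤 M) : ∃ U, 𝓤 U ∧ Nonempty (Retract M U) := by
  obtain ⟨n, U, a, b, hU, hab⟩ := hM
  obtain ⟨i, -, hi⟩ := IsLocalRing.exists_of_isUnit_sum (R := End M) (s := Finset.univ)
    (f := fun i => a i ≫ b i) (by rw [hab]; exact isUnit_one)
  have : IsIso (a i ≫ b i) := (isUnit_iff_isIso _).mp hi
  exact ⟨U i, hU i, ⟨a i, b i ≫ inv (a i ≫ b i), by rw [← Category.assoc, IsIso.hom_inv_id]⟩⟩

theorem indecomposable_and_additiveClosure_iff [HasBinaryBiproducts C] [IsIdempotentComplete C]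
    [𝓤.IsClosedUnderIsomorphisms] (h𝓤 : 𝓤 ≤ Indecomposable) {M : C} [IsArtinianRing (End M)] :
    Indecomposable M ∧ additiveClosure 𝓤 M ↔ 𝓤 M := by
  refine ⟨fun ⟨hM, hM'⟩ => ?_, fun hM => ⟨h𝓤 M hM, le_additiveClosure M hM⟩⟩
  have := isLocalRing_end hM
  obtain ⟨U, hU, ⟨h⟩⟩ := exists_retract_of_isLocalRing_end hM'
  obtain ⟨e⟩ := nonempty_iso_of_retract h (h𝓤 U hU) hM.1
  exact 𝓤.prop_of_iso e.symm hU

end AdditiveClosure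

section RetractIdeal

variable {C : Type*} [Category* C] [Preadditive C]

/-- The left ideal of `End N` generated by the idempotent of a retract of `N`, on which the
decomposition of `N` into indecomposable objects proceeds by induction. -/
def retractIdeal {M N : C} (h : Retract M N) : Ideal (End N) :=
  Ideal.span {End.of (h.r ≫ h.i)}

theorem retractIdeal_trans_lt {Y M N : C} (h : Retract Y M) (h' : Retract M N)
    (hne : h.r ≫ h.i ≠ 𝟙 M) :
    retractIdeal (h.trans h') < retractIdeal h' := by
  refine lt_of_le_not_ge ((Ideal.span_singleton_le_iff_mem _).mpr ?_) fun hle => hne ?_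
  · exact Ideal.mem_span_singleton'.mpr
      ⟨End.of ((h.trans h').r ≫ (h.trans h').i), by simp [End.mul_def, End.of]⟩
  · obtain ⟨x, hx : ((h.trans h').r ≫ (h.trans h').i) ≫ x.asHom = h'.r ≫ h'.i⟩ :=
      Ideal.mem_span_singleton'.mp ((Ideal.span_singleton_le_iff_mem _).mp hle)
    have h_id : h.r ≫ h.i ≫ h'.i ≫ x.asHom ≫ h'.r = 𝟙 M := by
      simpa using h'.i ≫= hx =≫ h'.r
    calc h.r ≫ h.i = (h.r ≫ h.i) ≫ h.r ≫ h.i ≫ h'.i ≫ x.asHom ≫ h'.r := by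
          rw [h_id, Category.comp_id]
      _ = 𝟙 M := by simpa using h_id

end RetractIdeal

section FiniteSums

variable {C : Type v} [Category.{w} C] [Abelian C] {𝓤 : ObjectProperty C}

attribute [local instance] Abelian.hasFiniteBiproducts

theorem finiteSums_of_isZero {M : C} (hM : IsZero M) : FiniteSums 𝓤 M :=
  ⟨0, Fin.elim0, fun i => i.elim0, ⟨hM.iso ((IsZero.iff_id_eq_zero _).mpr
    (biproduct.hom_ext _ _ fun i => i.elim0))⟩⟩

theorem le_finiteSums : 𝓤 ≤ FiniteSums 𝓤 := fun M hM =>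
  ⟨1, fun _ => M, fun _ => hM, ⟨(biproductUniqueIso fun _ : Fin 1 => M).symm⟩⟩

/-- A biproduct indexed by a disjoint union is the biproduct of the two partial biproducts. -/
def biprodBiproductIso {J K : Type} [Finite J] [Finite K] (W : J ⊕ K → C) :
    (⨁ fun i => W (Sum.inl i)) ⊞ (⨁ fun i => W (Sum.inr i)) ≅ ⨁ W where
  hom := biprod.desc (biproduct.desc fun i => biproduct.ι W (Sum.inl i))
    (biproduct.desc fun i => biproduct.ι W (Sum.inr i))
  inv := biproduct.desc (fun
    | Sum.inl i => biproduct.ι (fun i => W (Sum.inl i)) i ≫ biprod.inl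
    | Sum.inr i => biproduct.ι (fun i => W (Sum.inr i)) i ≫ biprod.inr)
  hom_inv_id := by
    apply biprod.hom_ext' <;> apply biproduct.hom_ext' <;> intro i <;> simp
  inv_hom_id := by
    apply biproduct.hom_ext'
    rintro (i | i) <;> simp

theorem finiteSums_of_iso_biprod {M Y Z : C} (e : M ≅ Y ⊞ Z) (hY : FiniteSums 𝓤 Y)
    (hZ : FiniteSums 𝓤 Z) : FiniteSums 𝓤 M := by
  obtain ⟨m, U, hU, ⟨a⟩⟩ := hY
  obtain ⟨n, V, hV, ⟨b⟩⟩ := hZ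
  have hW : ∀ i, 𝓤 (Sum.elim U V i) := Sum.rec hU hV
  exact ⟨m + n, Sum.elim U V ∘ finSumFinEquiv.symm, fun i => hW _,
    ⟨e ≪≫ biprod.mapIso a b ≪≫ biprodBiproductIso (Sum.elim U V) ≪≫
      (biproduct.reindex finSumFinEquiv.symm _).symm⟩⟩

theorem finiteSums_le_additiveClosure : FiniteSums 𝓤 ≤ additiveClosure 𝓤 :=
  fun _ ⟨n, U, hU, ⟨e⟩⟩ => additiveClosure_of_retract e.retract
    ⟨n, U, biproduct.π U, biproduct.ι U, hU, biproduct.total⟩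

theorem splitStructure_eq_homSurjectiveStructure (h𝓤 : ∀ M, additiveClosure 𝓤 M) :
    splitStructure C = homSurjectiveStructure 𝓤 := by
  ext S
  refine ⟨(isExactStructure_homSurjectiveStructure 𝓤).of_split S, fun ⟨hS, hg⟩ => ?_⟩
  obtain ⟨s, hs⟩ := (homSurjective_additiveClosure.ge S.g hg) S.X₃ (h𝓤 _) (𝟙 _)
  exact ⟨.ofExactOfSection S hS.exact s hs hS.mono_f⟩

theorem finiteSums_indecomposable (N : C) [IsArtinianRing (End N)] :
    FiniteSums Indecomposable N := by
  suffices H : ∀ (I : Ideal (End N)) (M : C) (h : Retract M N),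
      retractIdeal h = I → FiniteSums Indecomposable M from
    H _ N (.refl N) rfl
  intro I
  induction I using WellFoundedLT.induction with
  | _ I ih =>
    rintro M h rfl
    by_cases h0 : IsZero M
    · exact finiteSums_of_isZero h0
    by_cases hM : Indecomposable M
    · exact le_finiteSums M hM
    obtain ⟨e, he, he0, he1⟩ : ∃ e : M ⟶ M, e ≫ e = e ∧ e ≠ 0 ∧ e ≠ 𝟙 M := by
      simpa [indecomposable_iff, h0] using hM
    obtain ⟨Y, i, r, hir, hri⟩ := IsIdempotentComplete.idempotents_split M e he
    obtain ⟨Z, j, s, hjs, hsj⟩ := IsIdempotentComplete.idempotents_split M (𝟙 M - e) (by simp [he])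
    let hY : Retract Y M := ⟨i, r, hir⟩
    let hZ : Retract Z M := ⟨j, s, hjs⟩
    exact finiteSums_of_iso_biprod (isoBiprodOfTotal hY hZ (by simp [hY, hZ, hri, hsj]))
      (ih _ (retractIdeal_trans_lt hY h (hri ▸ he1)) Y _ rfl)
      (ih _ (retractIdeal_trans_lt hZ h (by simpa [hZ, hsj] using he0)) Z _ rfl)

theorem additiveClosure_eq_finiteSums [∀ M : C, IsArtinianRing (End M)]
    [𝓤.IsClosedUnderIsomorphisms] (h𝓤 : 𝓤 ≤ Indecomposable) :
    additiveClosure 𝓤 = FiniteSums 𝓤 := by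
  refine le_antisymm (fun M hM => ?_) finiteSums_le_additiveClosure
  obtain ⟨n, U, hU, ⟨e⟩⟩ := finiteSums_indecomposable M
  refine ⟨n, U, fun i => ?_, ⟨e⟩⟩
  have hUM : Retract (U i) M := ⟨biproduct.ι U i ≫ e.inv, e.hom ≫ biproduct.π U i, by simp⟩
  exact (indecomposable_and_additiveClosure_iff h𝓤).mp ⟨hU i, additiveClosure_of_retract hUM hM⟩

end FiniteSums

section RelProjective

variable {C : Type v} [Category.{w} C] [Abelian C] {𝓔 : ObjectProperty (ShortComplex C)}

theorem relProjective_of_projective (h𝓔 : ∀ S, 𝓔 S → S.ShortExact) (M : C) [Projective M] :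
    RelProjective 𝓔 M := by
  rintro Y Z g ⟨A, f, h, hS⟩ t
  have : Epi g := (h𝓔 _ hS).epi_g
  exact ⟨Projective.factorThru t g, Projective.factorThru_comp t g⟩

theorem relProjective_eq_additiveClosure {𝓤 : ObjectProperty C} (h𝓤 : 𝓤 ≤ RelProjective 𝓔)
    (h : ∀ M, ∃ (H : C) (g : H ⟶ M), additiveClosure 𝓤 H ∧ AdmissibleEpi 𝓔 g) :
    RelProjective 𝓔 = additiveClosure 𝓤 := by
  ext M
  refine ⟨fun hM => ?_, fun hM Y Z g hg => ?_⟩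
  · obtain ⟨H, g, hH, hg⟩ := h M
    obtain ⟨s, hs⟩ := hM g hg (𝟙 M)
    exact additiveClosure_of_retract ⟨s, g, hs⟩ hH
  · exact homSurjective_additiveClosure.ge g (fun U hU => h𝓤 U hU g hg) M hM

end RelProjective

theorem isSplitEpi_map_of_comp_eq_counit_app {C D : Type*} [Category* C] [Category* D] {F : C ⥤ D}
    {G : D ⥤ C} (adj : F ⊣ G) {Y M : D} {g : Y ⟶ M} {a : F.obj (G.obj M) ⟶ Y}
    (h : a ≫ g = adj.counit.app M) : IsSplitEpi (G.map g) :=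
  .mk' ⟨adj.unit.app (G.obj M) ≫ G.map a, by
    rw [Category.assoc, ← G.map_comp, h, adj.right_triangle_components]⟩

section PosetModules

variable (k : Type u) [Field k] {X : Type w} {P : Type w'} [PartialOrder X] [PartialOrder P]

instance [Finite P] (M : Rep k P) : IsArtinianRing (End M) := by
  let φ : End M →ₗ[k] (∀ p, M.obj p ⟶ M.obj p) :=
    { toFun := fun t p => t.app p
      map_add' := fun _ _ => rfl
      map_smul' := fun _ _ => rfl }
  have : Module.Finite k (End M) := .of_injective φ fun _ _ h => NatTrans.ext h
  exact .of_finite k (End M)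

instance (f : X ↪o P) : (embFunctor f).Full where
  map_surjective t := ⟨homOfLE (f.le_iff_le.mp (leOfHom t)), Subsingleton.elim _ _⟩

instance (f : X ↪o P) : (embFunctor f).Faithful where
  map_injective _ := Subsingleton.elim _ _

theorem epi_of_forall_epi_restriction_map {F : Set (X ↪o P)} (hF : ∀ p, ∃ f ∈ F, p ∈ Set.range f)
    {M N : Rep k P} {g : M ⟶ N} (hg : ∀ f ∈ F, Epi ((restriction k f).map g)) : Epi g := by
  rw [NatTrans.epi_iff_epi_app]
  intro p
  obtain ⟨f, hf, x, rfl⟩ := hF p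
  have := hg f hf
  exact (NatTrans.epi_iff_epi_app ((restriction k f).map g)).mp this x

variable [Finite X]

instance (f : X ↪o P) (U : Rep k X) : (embFunctor f).HasPointwiseLeftKanExtension U := fun p => by
  let _ : Fintype {x : X // f x ≤ p} := Fintype.ofFinite _
  have : HasColimitsOfShape (CostructuredArrow (embFunctor f) p) (FGModuleCat.{u} k) :=
    hasColimitsOfShape_of_equivalence (costructuredArrowEquiv f p).symm
  dsimp only [Functor.HasPointwiseLeftKanExtensionAt]
  infer_instance

instance (f : X ↪o P) : IsIso (extensionAdjunction k f).unit :=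
  inferInstanceAs (IsIso ((embFunctor f).lanAdjunction _).unit)

instance (f : X ↪o P) : (extension k f).Full :=
  (extensionAdjunction k f).full_L_of_isSplitEpi_unit_app

instance (f : X ↪o P) : (extension k f).Faithful :=
  (extensionAdjunction k f).faithful_L_of_mono_unit_app

instance (f : X ↪o P) : (extension k f).Additive :=
  (extensionAdjunction k f).left_adjoint_additive

variable {k} {E : Set (Emb X P)}

instance : (relHooks k E).IsClosedUnderIsomorphisms where
  of_iso e := fun ⟨f, U, hf, hU, ⟨e'⟩⟩ => ⟨f, U, hf, hU, ⟨e.symm ≪≫ e'⟩⟩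

theorem relHooks_iff {M : Rep k P} : relHooks k E M ↔
    ∃ f, Emb.mk f ∈ E ∧ ObjectProperty.map Indecomposable (extension k f) M :=
  ⟨fun ⟨f, U, hf, hU, ⟨e⟩⟩ => ⟨f, hf, U, hU, ⟨e.symm⟩⟩,
    fun ⟨f, hf, U, hU, ⟨e⟩⟩ => ⟨f, U, hf, hU, ⟨e.symm⟩⟩⟩

theorem relHooks_le_indecomposable : relHooks k E ≤ Indecomposable :=
  fun _ ⟨f, _, _, hU, ⟨e⟩⟩ =>
    ObjectProperty.prop_of_iso Indecomposable e.symm (indecomposable_obj (extension k f) hU)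

theorem homSurjective_relHooks_iff {M N : Rep k P} {g : M ⟶ N} :
    homSurjective (relHooks k E) g ↔
      ∀ f, Emb.mk f ∈ E → homSurjective Indecomposable ((restriction k f).map g) := by
  simp only [homSurjective_map_iff (extensionAdjunction k _)]
  refine ⟨fun h f hf U hU => h U (relHooks_iff.mpr ⟨f, hf, hU⟩), fun h U hU => ?_⟩
  obtain ⟨f, hf, hfU⟩ := relHooks_iff.mp hU
  exact h f hf U hfU

theorem relStructure_eq_homSurjectiveStructure :
    relStructure k E = homSurjectiveStructure (relHooks k E) := by
  have hsplit : splitStructure (Rep k X) = homSurjectiveStructure Indecomposable :=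
    splitStructure_eq_homSurjectiveStructure fun U =>
      finiteSums_le_additiveClosure U (finiteSums_indecomposable U)
  ext S
  unfold relStructure pullbackStructure
  rw [hsplit]
  refine and_congr_right fun hS =>
    (forall₂_congr fun f _ => ?_).trans homSurjective_relHooks_iff.symm
  exact and_iff_right (hS.map_of_exact (restriction k f))

theorem additiveClosure_relHooks_extension_obj {f : X ↪o P} (hf : Emb.mk f ∈ E) (U : Rep k X) :
    additiveClosure (relHooks k E) ((extension k f).obj U) := by
  have hle : ObjectProperty.map Indecomposable (extension k f) ≤ relHooks k E :=
    fun _ hM => relHooks_iff.mpr ⟨f, hf, hM⟩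
  exact additiveClosure_mono hle _ (additiveClosure_map_obj _
    (finiteSums_le_additiveClosure U (finiteSums_indecomposable U)))

variable (hE : ∀ p : P, ∃ f : X ↪o P, Emb.mk f ∈ E ∧ p ∈ Set.range f)
include hE

theorem admissibleEpi_relStructure_of_isSplitEpi {M N : Rep k P} {g : M ⟶ N}
    (hg : ∀ f, Emb.mk f ∈ E → IsSplitEpi ((restriction k f).map g)) :
    AdmissibleEpi (relStructure k E) g := by
  rw [relStructure_eq_homSurjectiveStructure, admissibleEpi_homSurjectiveStructure_iff]
  refine ⟨epi_of_forall_epi_restriction_map k (F := {f | Emb.mk f ∈ E}) hE fun f hf => ?_,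
    homSurjective_relHooks_iff.mpr fun f hf => ?_⟩
  · have := hg f hf
    infer_instance
  · have := hg f hf
    exact homSurjective_of_isSplitEpi _

attribute [local instance] Abelian.hasFiniteBiproducts

theorem exists_admissibleEpi_relStructure [Finite P] (M : Rep k P) :
    ∃ (H : Rep k P) (g : H ⟶ M),
      additiveClosure (relHooks k E) H ∧ AdmissibleEpi (relStructure k E) g := by
  have : Finite (X ↪o P) := DFunLike.finite _
  obtain ⟨n, ⟨ε⟩⟩ := Finite.exists_equiv_fin {f : X ↪o P // Emb.mk f ∈ E}
  let F (i : Fin n) : X ↪o P := (ε.symm i).1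
  let H (i : Fin n) : Rep k P := (extension k (F i)).obj ((restriction k (F i)).obj M)
  let g : ⨁ H ⟶ M := biproduct.desc fun i => (extensionAdjunction k (F i)).counit.app M
  refine ⟨⨁ H, g, ?_, admissibleEpi_relStructure_of_isSplitEpi hE fun f hf => ?_⟩
  · rw [← additiveClosure_additiveClosure]
    exact finiteSums_le_additiveClosure _ ⟨n, H, fun i =>
      additiveClosure_relHooks_extension_obj (ε.symm i).2 _, ⟨Iso.refl _⟩⟩
  · obtain ⟨i, rfl⟩ : ∃ i, F i = f := ⟨ε ⟨f, hf⟩, by simp [F]⟩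
    have hg : biproduct.ι H i ≫ g = (extensionAdjunction k (F i)).counit.app M :=
      biproduct.ι_desc _ i
    exact isSplitEpi_map_of_comp_eq_counit_app (extensionAdjunction k (F i)) hg

theorem relProjective_eq_additiveClosure_relHooks [Finite P] :
    RelProjective (relStructure k E) = additiveClosure (relHooks k E) := by
  refine relProjective_eq_additiveClosure (fun M hM Y Z g hg => ?_)
    (exists_admissibleEpi_relStructure hE)
  rw [relStructure_eq_homSurjectiveStructure, admissibleEpi_homSurjectiveStructure_iff] at hg
  exact hg.2 M hM

end PosetModules

end PosetRep

end

open PosetRep in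
theorem mainTheorem3_general (k : Type*) [Field k]
    (X : Type*) (P : Type*) [PartialOrder X] [PartialOrder P] [Finite X] [Finite P]
    (E : Set (Emb X P))
    (hE : ∀ p : P, ∃ f : X ↪o P, Emb.mk f ∈ E ∧ p ∈ Set.range f) :
    relHooks k E ≤ Indecomposable ∧
    (∀ M : Rep k P, Indecomposable M → Projective M → relHooks k E M) ∧
    IsExactStructure (relStructure k E) ∧
    relStructure k E = homSurjectiveStructure (relHooks k E) ∧
    (∀ M : Rep k P,
      (Indecomposable M ∧ RelProjective (relStructure k E) M) ↔ relHooks k E M) ∧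
    RelProjective (relStructure k E) = FiniteSums (relHooks k E) := by
  have h_ind : relHooks k E ≤ Indecomposable := relHooks_le_indecomposable
  have h_eq : relStructure k E = homSurjectiveStructure (relHooks k E) :=
    relStructure_eq_homSurjectiveStructure
  have h_exact : IsExactStructure (relStructure k E) :=
    h_eq ▸ isExactStructure_homSurjectiveStructure _
  have h_proj : RelProjective (relStructure k E) = additiveClosure (relHooks k E) :=
    relProjective_eq_additiveClosure_relHooks hE
  have h_hooks (M : Rep k P) :
      Indecomposable M ∧ RelProjective (relStructure k E) M ↔ relHooks k E M :=
    h_proj ▸ indecomposable_and_additiveClosure_iff h_ind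
  have h_projective (M : Rep k P) (hM : Indecomposable M) (_ : Projective M) : relHooks k E M :=
    (h_hooks M).mp ⟨hM, relProjective_of_projective h_exact.shortExact M⟩
  exact ⟨h_ind, h_projective, h_exact, h_eq, h_hooks,
    h_proj.trans (additiveClosure_eq_finiteSums h_ind)⟩

theorem mainTheorem3 (k : Type*) [Field k]
    (X : Type*) (P : Type*) [PartialOrder X] [PartialOrder P] [Finite X] [Finite P]
    (hX : PosetRep.RepresentationFinite k X)
    (E : Set (PosetRep.Emb X P))
    (hE : ∀ p : P, ∃ f : X ↪o P, PosetRep.Emb.mk f ∈ E ∧ p ∈ Set.range f) :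
    PosetRep.relHooks k E ≤ Indecomposable ∧
    (∀ M : PosetRep.Rep k P, Indecomposable M → Projective M → PosetRep.relHooks k E M) ∧
    PosetRep.IsExactStructure (PosetRep.relStructure k E) ∧
    PosetRep.relStructure k E = PosetRep.homSurjectiveStructure (PosetRep.relHooks k E) ∧
    (∀ M : PosetRep.Rep k P,
      (Indecomposable M ∧ PosetRep.RelProjective (PosetRep.relStructure k E) M) ↔
        PosetRep.relHooks k E M) ∧
    PosetRep.RelProjective (PosetRep.relStructure k E) =
      PosetRep.FiniteSums (PosetRep.relHooks k E) :=
  mainTheorem3_general k X P E hE
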